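/- Let $Q_{2n}$ be the hypercube whose vertices are the binary strings of length $2n$, two strings being adjacent iff they differ in exactly one bit. Label the 4-cycle $00,01,11,10$ of two-bit strings by $0,1,2,3\in\mathbb{Z}/4$; cutting a binary string of length $2n$ into $n$ consecutive two-bit blocks and labelling each block identifies $Q_{2n}$ with the Cartesian product $C_4\,\Box\cdots\Box\,C_4$ ($n$ factors), whose vertices are the strings $(x_1,\dots,x_n)\in(\mathbb{Z}/4)^n$. A permutation $\sigma$ of $\{1,\dots,n\}$ acts on these vertices by relabelling the axes, $\sigma(x_1,\dots,x_n)=(x_{\sigma^{-1}(1)},\dots,x_{\sigma^{-1}(n)})$, and hence acts on directed cycles of $Q_{2n}$. A Hamilton decomposition of $Q_{2n}$ is a family of $n$ Hamilton cycles whose edge sets partition the edge set of $Q_{2n}$. A Latin family is a family $\sigma_1,\dots,\sigma_n$ of permutations of $\{1,\dots,n\}$ with $\sigma_1$ the identity such that the matrix $(\sigma_i(j))_{i,j}$ is a Latin square. A directed Hamilton cycle $H$ of $Q_{2n}$, with the origin $00\cdots0$ as its initial vertex, is called a source cycle for $Q_{2n}$ if there is a Latin family $\sigma_1,\dots,\sigma_n$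 such that $\sigma_1(H),\dots,\sigma_n(H)$ is a Hamilton decomposition of $Q_{2n}$. If $Q_{2n}$ has a source cycle, then $Q_{6n}$ has a source cycle. -/

import Mathlib

namespace HypercubeHD

/-- The hypercube `Q_d`: vertices are binary strings of length `d`, and two strings are adjacent
iff they differ in exactly one bit. -/
def hypercube (d : ℕ) : SimpleGraph (Fin d → Bool) where
  Adj u v := ∃! i, u i ≠ v i
  symm := ⟨by
    rintro u v ⟨i, hi, h⟩
    exact ⟨i, Ne.symm hi, fun j hj => h j (Ne.symm hj)⟩⟩
  loopless := ⟨by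
    rintro u ⟨i, hi, -⟩
    exact hi rfl⟩

/-- The `k`-fold Cartesian product `C_m □ ⋯ □ C_m`: two vertices are adjacent iff they differ in
exactly one coordinate, and in that coordinate they differ by `1` or `-1` modulo `m`.
The graph `G_{n,k}` is `torus (4 ^ n) k`, and `torus 4 n` is `Q_{2n}` in quaternary coordinates. -/
def torus (m k : ℕ) : SimpleGraph (Fin k → ZMod m) where
  Adj u v := ∃ i, u i ≠ v i ∧ (v i = u i + 1 ∨ u i = v i + 1) ∧ ∀ j, j ≠ i → u j = v j
  symm := ⟨by
    rintro u v ⟨i, hi, h, hj⟩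
    exact ⟨i, Ne.symm hi, h.symm, fun j hne => (hj j hne).symm⟩⟩
  loopless := ⟨by
    rintro u ⟨i, hi, -⟩
    exact hi rfl⟩

/-- Relabelling of the axes of `torus m k`: the axis called `i` is now called `σ i`, i.e.
`(x_1, …, x_k)` is sent to `(x_{σ⁻¹(1)}, …, x_{σ⁻¹(k)})`. -/
def axisIso {m k : ℕ} (σ : Equiv.Perm (Fin k)) : torus m k ≃g torus m k where
  toFun x := fun i => x (σ.symm i)
  invFun x := fun i => x (σ i)
  left_inv x := by funext i; simp
  right_inv x := by funext i; simp
  map_rel_iff' := by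
    intro u v
    constructor
    · rintro ⟨i, hi, h, hj⟩
      refine ⟨σ.symm i, hi, h, fun j hne => ?_⟩
      have := hj (σ j) (fun e => hne (by simp [← e]))
      simpa using this
    · rintro ⟨i, hi, h, hj⟩
      refine ⟨σ i, by simpa using hi, by simpa using h, fun j hne => ?_⟩
      exact hj (σ.symm j) (fun e => hne (by simp [← e]))

/-- A family of closed walks is a Hamilton decomposition of `G` if its members are Hamilton
cycles that partition the edge set of `G`. -/
structure IsHamiltonDecomposition {V : Type*} [DecidableEq V] (G : SimpleGraph V)
    {ι : Type*} {b : ι → V} (C : (i : ι) → G.Walk (b i) (b i)) : Prop where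
  hamiltonian : ∀ i, (C i).IsHamiltonianCycle
  disjoint : ∀ i j, i ≠ j → ∀ e, e ∈ (C i).edges → e ∉ (C j).edges
  cover : ∀ e ∈ G.edgeSet, ∃ i, e ∈ (C i).edges

/-- A Latin family of permutations: the matrix `(i, j) ↦ σ i j` is a Latin square (each row is a
permutation by typing, and so is each column) whose first row is the identity. -/
structure IsLatinFamily {k : ℕ} (σ : Fin k → Equiv.Perm (Fin k)) : Prop where
  column : ∀ j, Function.Bijective fun i => σ i j
  first : ∀ i : Fin k, (i : ℕ) = 0 → σ i = 1

/-- The directed Hamilton cycle `H` is a source cycle of `torus m k`: for some Latin family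
`σ_1, …, σ_k`, the cycles `σ_1(H), …, σ_k(H)` form a Hamilton decomposition. -/
def IsSourceCycle {m k : ℕ} {v : Fin k → ZMod m} (H : (torus m k).Walk v v) : Prop :=
  H.IsHamiltonianCycle ∧ ∃ σ : Fin k → Equiv.Perm (Fin k), IsLatinFamily σ ∧
    IsHamiltonDecomposition (torus m k) fun i => H.map (axisIso (σ i)).toHom

/-- The labelling of the `4`-cycle `00, 01, 11, 10` of two-bit strings by `0, 1, 2, 3`. -/
def digitEquiv : Bool × Bool ≃ ZMod 4 where
  toFun p := match p with
    | (false, false) => 0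
    | (false, true) => 1
    | (true, true) => 2
    | (true, false) => 3
  invFun z :=
    if z = 0 then (false, false) else if z = 1 then (false, true)
    else if z = 2 then (true, true) else (true, false)
  left_inv := by decide
  right_inv := by decide

theorem digit_adj (p q : Bool × Bool) :
    (digitEquiv p ≠ digitEquiv q ∧
      (digitEquiv q = digitEquiv p + 1 ∨ digitEquiv p = digitEquiv q + 1)) ↔
    ((p.1 ≠ q.1 ∧ p.2 = q.2) ∨ (p.1 = q.1 ∧ p.2 ≠ q.2)) := by
  revert p q; decide

/-- The two bits of `u` that make up its `i`-th quaternary digit. -/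
def bits {n : ℕ} (u : Fin (2 * n) → Bool) (i : Fin n) : Bool × Bool :=
  (u ⟨2 * i, by omega⟩, u ⟨2 * i + 1, by omega⟩)

theorem apply_eq_bits {n : ℕ} (u : Fin (2 * n) → Bool) (t : Fin (2 * n)) :
    u t = if (t : ℕ) % 2 = 0 then (bits u ⟨t / 2, by omega⟩).1
      else (bits u ⟨t / 2, by omega⟩).2 := by
  unfold bits
  split_ifs with h
  · exact congrArg u (Fin.ext (by simp; omega))
  · exact congrArg u (Fin.ext (by simp; omega))

theorem adj_iff_bits {n : ℕ} (u v : Fin (2 * n) → Bool) :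
    (hypercube (2 * n)).Adj u v ↔
      ∃ i : Fin n, (((bits u i).1 ≠ (bits v i).1 ∧ (bits u i).2 = (bits v i).2) ∨
        ((bits u i).1 = (bits v i).1 ∧ (bits u i).2 ≠ (bits v i).2)) ∧
        ∀ j, j ≠ i → bits u j = bits v j := by
  constructor
  · rintro ⟨t, ht, huniq⟩
    have key : ∀ s : Fin (2 * n), s ≠ t → u s = v s := fun s hs => by
      by_contra hne
      exact hs (huniq s hne)
    refine ⟨⟨t / 2, by omega⟩, ?_, fun j hj => ?_⟩
    · rw [ne_eq, apply_eq_bits u t, apply_eq_bits v t] at ht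
      by_cases h : (t : ℕ) % 2 = 0
      · simp only [h, if_true] at ht
        exact Or.inl ⟨ht, key _ (fun e => by have := congrArg Fin.val e; simp at this; omega)⟩
      · simp only [h, if_false] at ht
        exact Or.inr ⟨key _ (fun e => by have := congrArg Fin.val e; simp at this; omega), ht⟩
    · have hne : (j : ℕ) ≠ t / 2 := fun e => hj (Fin.ext e)
      refine Prod.ext (key _ fun e => ?_) (key _ fun e => ?_)
      · have := congrArg Fin.val e; simp at this; omega
      · have := congrArg Fin.val e; simp at this; omega
  · rintro ⟨i, hi, hj⟩
    have key : ∀ s : Fin (2 * n), u s ≠ v s → (s : ℕ) / 2 = i := fun s hs => by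
      by_contra hne
      apply hs
      rw [apply_eq_bits u s, apply_eq_bits v s, hj _ (fun e => hne (congrArg Fin.val e))]
    rcases hi with ⟨h1, h2⟩ | ⟨h1, h2⟩
    · refine ⟨⟨2 * i, by omega⟩, h1, fun s hs => Fin.ext ?_⟩
      have hk := key s hs
      by_contra hne
      apply hs
      have : s = ⟨2 * i + 1, by omega⟩ := Fin.ext (by simp at hne ⊢; omega)
      rw [this]; exact h2
    · refine ⟨⟨2 * i + 1, by omega⟩, h2, fun s hs => Fin.ext ?_⟩
      have hk := key s hs
      by_contra hne
      apply hs
      have : s = ⟨2 * i, by omega⟩ := Fin.ext (by simp at hne ⊢; omega)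
      rw [this]; exact h1

/-- The quaternary coordinates of `Q_{2n} = C_4 □ ⋯ □ C_4`: a binary string of length `2n` is cut
into `n` blocks of two bits, and each block is replaced by its digit. -/
def quaternary (n : ℕ) : hypercube (2 * n) ≃g torus 4 n where
  toFun u := fun i => digitEquiv (bits u i)
  invFun x := fun t =>
    if (t : ℕ) % 2 = 0 then (digitEquiv.symm (x ⟨t / 2, by omega⟩)).1
    else (digitEquiv.symm (x ⟨t / 2, by omega⟩)).2
  left_inv u := by
    funext t
    simp only [Equiv.symm_apply_apply]
    exact (apply_eq_bits u t).symm
  right_inv x := by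
    funext i
    have h1 : (2 * (i : ℕ) + 1) / 2 = i := by omega
    have h2 : (2 * (i : ℕ) + 1) % 2 = 1 := by omega
    simp [bits, h1]
  map_rel_iff' := by
    intro u v
    rw [adj_iff_bits]
    change (∃ i, digitEquiv (bits u i) ≠ digitEquiv (bits v i) ∧ _ ∧ _) ↔ _
    refine exists_congr fun i => ?_
    rw [← and_assoc, ← digit_adj (bits u i) (bits v i)]
    simp

/-- `Q_{2n}` has a source cycle: some closed walk of `Q_{2n}` that starts at the origin is a source
cycle in quaternary coordinates. -/
def HasSourceCycle (n : ℕ) : Prop :=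
  ∃ H : (hypercube (2 * n)).Walk (fun _ => false) (fun _ => false),
    IsSourceCycle (H.map (quaternary n).toHom)

end HypercubeHD

/-! Put m = 4^n and let C_1, …, C_n be the cycles σ_i(H) decomposing C_4^n. An edge of Q_{6n} =
(C_4^n)^3 moves one block along an edge of exactly one C_i, and the other two blocks are vertices of
that same Hamilton cycle. So the edges split into n spanning copies C_i × C_i × C_i of `torus m 3`
(`glue_edges_disjoint`, `glue_edges_cover`). It remains to find one Hamilton cycle of `torus m 3`
whose three cyclic axis shifts partition the edges: transported along H and relabelled by the pairs
(shift j, σ_i), it yields the 3n cycles, and the product of the two Latin squares is Latin.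

The cycle `next` always adds 1 to one coordinate. Its axis is constant on each layer x + y + z = s
with s ≠ 0; on the layer s = 0 the table `layerDir` makes the three shifts leave each vertex along
different axes (`dir_shift_bijective`) and keeps `next` injective.

That there is only one orbit follows from two successive return maps. On the layer s = 0, in
coordinates (x, y), the return moves are (1,1), (0,2) and (0,1). On its row y = 0, even x ≥ 4 goes
to x - 1 and odd x ≥ 7 to x - 5, with a few small exceptions. Large even x thus descend by 6, and
since m ≡ 4 mod 6, as for every 4^n with n ≥ 1, the exceptions link the residue classes
(`row_reaches_origin`). The case m = 4 is a computation. -/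

namespace HypercubeHD

/-! ### Hamilton cycles as cyclic enumerations -/

section CyclicSequences

variable {V : Type*} {G : SimpleGraph V}

/-- The walk that visits `c 0, c 1, …, c n` in this order. -/
def seqWalk (c : ℕ → V) (hc : ∀ t, G.Adj (c t) (c (t + 1))) : (n : ℕ) → G.Walk (c 0) (c n)
  | 0 => .nil
  | n + 1 => (seqWalk c hc n).concat (hc n)

theorem length_seqWalk (c : ℕ → V) (hc : ∀ t, G.Adj (c t) (c (t + 1))) (n : ℕ) :
    (seqWalk c hc n).length = n := by
  induction n with
  | zero => rfl
  | succ n ih => simp [seqWalk, ih]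

theorem getVert_seqWalk (c : ℕ → V) (hc : ∀ t, G.Adj (c t) (c (t + 1))) (n : ℕ) :
    ∀ i ≤ n, (seqWalk c hc n).getVert i = c i := by
  induction n with
  | zero => intro i hi; obtain rfl : i = 0 := by omega
            rfl
  | succ n ih =>
    intro i hi
    rcases Nat.lt_or_ge n i with h | h
    · obtain rfl : i = n + 1 := by omega
      have := (seqWalk c hc (n + 1)).getVert_length
      rwa [length_seqWalk] at this
    · rw [seqWalk, SimpleGraph.Walk.concat_eq_append, SimpleGraph.Walk.getVert_append,
        length_seqWalk]
      split_ifs with h'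
      · exact ih i h
      · obtain rfl : i = n := by omega
        simp

/-- A permutation that is a single cycle and moves along edges traces out a Hamilton cycle. -/
theorem exists_isHamiltonianCycle_of_isCycleOn {W : Type*} [Fintype W] [DecidableEq V]
    (e : Equiv.Perm W) (he : e.IsCycleOn (Finset.univ : Finset W)) (φ : W ≃ V)
    (hadj : ∀ w, G.Adj (φ w) (φ (e w))) (hcard : 3 ≤ Fintype.card W) (w₀ : W) :
    ∃ H : G.Walk (φ w₀) (φ w₀), H.IsHamiltonianCycle ∧
      ∀ ed, ed ∈ H.edges ↔ ∃ w, ed = s(φ w, φ (e w)) := by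
  classical
  have : Fintype V := Fintype.ofEquiv W φ
  set N := Fintype.card W with hN
  have hNV : Fintype.card V = N := (Fintype.card_congr φ).symm
  have hper : (e ^ N) w₀ = w₀ := by
    have := he.pow_card_apply (Finset.mem_univ w₀)
    simpa [hN, Finset.card_univ] using this
  have hreach : ∀ w, ∃ t < N, (e ^ t) w₀ = w := fun w => by
    simpa [hN, Finset.card_univ] using
      he.exists_pow_eq (Finset.mem_univ w₀) (Finset.mem_univ w)
  have hinj : ∀ i j : ℕ, i < N → j < N → (e ^ i) w₀ = (e ^ j) w₀ → i = j := by
    have hs : Function.Surjective (fun i : Fin N => (e ^ (i : ℕ)) w₀) := fun w => by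
      obtain ⟨t, ht, h⟩ := hreach w
      exact ⟨⟨t, ht⟩, h⟩
    have hb := (Fintype.bijective_iff_surjective_and_card _).2 ⟨hs, by simp [hN]⟩
    intro i j hi hj hij
    exact congrArg Fin.val (hb.1 (a₁ := ⟨i, hi⟩) (a₂ := ⟨j, hj⟩) hij)
  let c : ℕ → V := fun t => φ ((e ^ t) w₀)
  have hc : ∀ t, G.Adj (c t) (c (t + 1)) := fun t => by
    simp only [c, pow_succ', Equiv.Perm.mul_apply]; exact hadj _
  have hc0 : c 0 = φ w₀ := by simp [c]
  have hcN : c N = φ w₀ := by simp [c, hper]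
  let H : G.Walk (φ w₀) (φ w₀) := (seqWalk c hc N).copy hc0 hcN
  have hlen : H.length = N := by simp [H, length_seqWalk]
  have hget : ∀ i ≤ N, H.getVert i = c i := fun i hi => by
    simp [H, getVert_seqWalk c hc N i hi]
  have hnil : ¬ H.Nil := by
    rw [SimpleGraph.Walk.not_nil_iff_lt_length]; omega
  refine ⟨H, ?_, ?_⟩
  · rw [SimpleGraph.Walk.isHamiltonianCycle_iff_isCycle_and_length_eq]
    refine ⟨SimpleGraph.Walk.isCycle_iff_isPath_tail_and_le_length.2 ⟨?_, by omega⟩, by omega⟩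
    rw [← SimpleGraph.Walk.IsPath.getVert_injOn_iff]
    intro i hi j hj hij
    have hl := SimpleGraph.Walk.length_tail_add_one hnil
    simp only [Set.mem_ofPred_eq] at hi hj
    simp only [SimpleGraph.Walk.getVert_tail] at hij
    rw [hget _ (by omega), hget _ (by omega)] at hij
    -- The tail shifts indices by one, so index N can occur; cancelling one `e` brings both
    -- exponents below N.
    have h1 := φ.injective hij
    simp only [pow_succ', Equiv.Perm.mul_apply] at h1
    exact hinj i j (by omega) (by omega) (e.injective h1)
  · intro ed
    induction ed using Sym2.ind with
    | _ u v =>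
    rw [SimpleGraph.Walk.mk_mem_edges_iff_exists]
    constructor
    · rintro ⟨i, hi, h⟩
      rw [hget _ (by omega), hget _ (by omega)] at h
      refine ⟨(e ^ i) w₀, ?_⟩
      rw [← h]
      simp [c, pow_succ']
    · rintro ⟨w, h⟩
      obtain ⟨t, ht, rfl⟩ := hreach w
      refine ⟨t, by omega, ?_⟩
      rw [hget _ (by omega), hget _ (by omega), h]
      simp [c, pow_succ']

/-- The vertices of a Hamilton cycle, enumerated cyclically along it. -/
theorem exists_cyclic_enumeration [Fintype V] [DecidableEq V] {v : V} (H : G.Walk v v)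
    (hH : H.IsHamiltonianCycle) {N : ℕ} [NeZero N] (hN : Fintype.card V = N) :
    ∃ c : ZMod N ≃ V, c 0 = v ∧ (∀ t, G.Adj (c t) (c (t + 1))) ∧
      ∀ ed, ed ∈ H.edges ↔ ∃ t, ed = s(c t, c (t + 1)) := by
  have hlen : H.length = N := by rw [hH.length_eq, hN]
  have h3 := hH.isCycle.three_le_length
  let c : ZMod N → V := fun t => H.getVert t.val
  have hinj : Function.Injective c := fun s t h => by
    have hs := ZMod.val_lt s
    have ht := ZMod.val_lt t
    exact ZMod.val_injective N
      (hH.isCycle.getVert_injOn' (by simp only [Set.mem_ofPred_eq]; omega)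
        (by simp only [Set.mem_ofPred_eq]; omega) h)
  have hbij : Function.Bijective c :=
    (Fintype.bijective_iff_injective_and_card _).2 ⟨hinj, by simp [hN, ZMod.card]⟩
  have : Fact (1 < N) := ⟨by omega⟩
  have hsucc : ∀ t : ZMod N, c (t + 1) = H.getVert (t.val + 1) := fun t => by
    have ht := ZMod.val_lt t
    simp only [c, ZMod.val_add, ZMod.val_one]
    -- At t = N - 1 the index wraps to 0, and the walk has closed up at `v`.
    rcases Nat.lt_or_ge (t.val + 1) N with h | h
    · rw [Nat.mod_eq_of_lt h]
    · have : t.val + 1 = H.length := by omega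
      rw [this, H.getVert_length, hlen, Nat.mod_self, H.getVert_zero]
  refine ⟨Equiv.ofBijective c hbij, by simp [c], fun t => ?_, fun ed => ?_⟩
  · have ht := ZMod.val_lt t
    rw [Equiv.ofBijective_apply, Equiv.ofBijective_apply, hsucc]
    exact H.adj_getVert_succ (by omega)
  · induction ed using Sym2.ind with
    | _ a b =>
    simp only [Equiv.ofBijective_apply, hsucc]
    rw [SimpleGraph.Walk.mk_mem_edges_iff_exists]
    constructor
    · rintro ⟨i, hi, h⟩
      refine ⟨(i : ZMod N), ?_⟩
      simp only [c, ZMod.val_natCast, Nat.mod_eq_of_lt (show i < N by omega), h]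
    · rintro ⟨t, h⟩
      have ht := ZMod.val_lt t
      exact ⟨t.val, by omega, h.symm⟩

end CyclicSequences

/-! ### A cycle in `torus m 3` and its three shifts -/

/-- The axis along which the source cycle of `torus m 3` leaves a vertex of the layer
`x + y + z = 0`. -/
def layerDir {m : ℕ} (x y z : ZMod m) : Fin 3 :=
  if y = 0 then if x = 0 then 0 else if x = 1 then 1 else 2
  else if z = 0 then if x = 1 then 2 else 1
  else if x = 0 then if y = 1 then 2 else if z = 1 then 1 else 0
  else 0

/-- The axis along which the source cycle of `torus m 3` leaves a vertex. -/
def dir {m : ℕ} (v : Fin 3 → ZMod m) : Fin 3 :=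
  if v 0 + v 1 + v 2 = 0 then layerDir (v 0) (v 1) (v 2)
  else if v 0 + v 1 + v 2 = 1 then 1 else 2

/-- The successor of a vertex on the source cycle of `torus m 3`. -/
def next {m : ℕ} (v : Fin 3 → ZMod m) : Fin 3 → ZMod m := v + Pi.single (dir v) 1

/-- The cycle relabelled by the shift `j` leaves `v` along this axis, so the three shifts share out
the positive edges at `v`. Rotating coordinates preserves their sum: off the layer 0 all three
values of `dir` agree and the shifts separate them, while on that layer the table is checked case by
case. -/
theorem dir_shift_bijective {m : ℕ} (hm : 4 ≤ m) (v : Fin 3 → ZMod m) :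
    Function.Bijective fun j : Fin 3 => dir (fun i => v (i + j)) + j := by
  have : Fact (1 < m) := ⟨by omega⟩
  have h2 : (2 : ZMod m) ≠ 0 := by
    intro h
    have := (ZMod.natCast_eq_zero_iff 2 m).1 (by exact_mod_cast h)
    exact absurd (Nat.le_of_dvd (by norm_num) this) (by omega)
  rw [Fintype.bijective_iff_injective_and_card]
  refine ⟨?_, rfl⟩
  obtain ⟨x, hx⟩ : ∃ x, v 0 = x := ⟨_, rfl⟩
  obtain ⟨y, hy⟩ : ∃ x, v 1 = x := ⟨_, rfl⟩
  obtain ⟨z, hz⟩ : ∃ x, v 2 = x := ⟨_, rfl⟩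
  have e1 : (1 : Fin 3) + 1 = 2 := rfl
  have e2 : (2 : Fin 3) + 1 = 0 := rfl
  have e3 : (1 : Fin 3) + 2 = 0 := rfl
  have e4 : (2 : Fin 3) + 2 = 1 := rfl
  have key : ∀ a b c : Fin 3, a ≠ b + 1 → a ≠ c + 2 → b + 1 ≠ c + 2 →
      Function.Injective (fun j : Fin 3 => (![a, b, c] j) + j) := by decide
  have hfun : (fun j : Fin 3 => dir (fun i => v (i + j)) + j) =
      fun j => ![dir ![x, y, z], dir ![y, z, x], dir ![z, x, y]] j + j := by
    funext j
    congr 1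
    fin_cases j
    all_goals
      refine congrArg dir (funext fun i => ?_)
      fin_cases i <;> simp [hx, hy, hz, e1, e2, e3, e4]
  rw [hfun]
  by_cases hs : x + y + z = 0
  · have hs2 : z + x + y = 0 := by rw [← hs]; ring
    obtain rfl : z = -x - y := by linear_combination hs
    apply key <;> simp [dir, hs, hs2, layerDir] <;> grind
  · have hs1 : y + z + x = x + y + z := by ring
    have hs2 : z + x + y = x + y + z := by ring
    rcases eq_or_ne (x + y + z) 1 with h1 | h1 <;> apply key <;>
      simp [dir, hs1, hs2, hs, h1]

/-- The axis along which the source cycle of `torus m 3` enters a vertex of the layer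
`x + y + z = 1`. -/
def layerDirInv {m : ℕ} (x y z : ZMod m) : Fin 3 :=
  if y = 0 then if x = 1 then 0 else if x = 0 then 1 else 2
  else if z = 0 then if x = 0 then 2 else 1
  else if x = 1 then if y = 1 then 1 else if z = 1 then 2 else 0
  else 0

theorem layerDirInv_next {m : ℕ} (hm : 4 ≤ m) (v : Fin 3 → ZMod m) (hv : v 0 + v 1 + v 2 = 0) :
    layerDirInv (next v 0) (next v 1) (next v 2) = dir v := by
  have : Fact (1 < m) := ⟨by omega⟩
  have h2 : (2 : ZMod m) ≠ 0 := by
    intro h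
    have := (ZMod.natCast_eq_zero_iff 2 m).1 (by exact_mod_cast h)
    exact absurd (Nat.le_of_dvd (by norm_num) this) (by omega)
  have hz : v 2 = -v 0 - v 1 := by linear_combination hv
  have hd : dir v = layerDir (v 0) (v 1) (v 2) := by simp [dir, hv]
  simp only [next, Pi.add_apply, hd, hz]
  clear hd hz hv
  generalize v 0 = a
  generalize v 1 = b
  unfold layerDir
  split_ifs <;> simp [layerDirInv] <;> grind

/-- The image determines the layer, since each step raises the sum by 1. The axis is then known,
except from layer 0 to layer 1, where `layerDirInv` recovers it from the image. -/
theorem next_injective {m : ℕ} (hm : 4 ≤ m) : Function.Injective (next (m := m)) := by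
  intro u v h
  have hsum : ∀ w : Fin 3 → ZMod m, next w 0 + next w 1 + next w 2 = w 0 + w 1 + w 2 + 1 := by
    intro w
    simp only [next, Pi.add_apply]
    generalize dir w = d
    fin_cases d <;> simp <;> ring
  have hs : u 0 + u 1 + u 2 = v 0 + v 1 + v 2 := by
    have := hsum u
    rw [h, hsum v] at this
    exact (add_right_cancel this).symm
  suffices hd : dir u = dir v by
    simp only [next, hd] at h
    exact add_right_cancel h
  by_cases h0 : v 0 + v 1 + v 2 = 0
  · rw [← layerDirInv_next hm u (hs.trans h0), ← layerDirInv_next hm v h0, h]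
  · simp [dir, hs, h0]

/-! ### Orbits and the return map on the layer x + y + z = 0 -/

/-- `v` lies on the forward orbit of `u` under `next`. -/
def Reaches {m : ℕ} (u v : Fin 3 → ZMod m) : Prop := ∃ k : ℕ, next^[k] u = v

theorem Reaches.refl {m : ℕ} (u : Fin 3 → ZMod m) : Reaches u u := ⟨0, rfl⟩

theorem Reaches.trans {m : ℕ} {u v w : Fin 3 → ZMod m} (h : Reaches u v) (h' : Reaches v w) :
    Reaches u w := by
  obtain ⟨k, rfl⟩ := h
  obtain ⟨l, rfl⟩ := h'
  exact ⟨l + k, Function.iterate_add_apply _ _ _ _⟩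

theorem reaches_next {m : ℕ} (u : Fin 3 → ZMod m) : Reaches u (next u) := ⟨1, rfl⟩

/-- The vertex of the layer `x + y + z = 0` with given first two coordinates. -/
def layerPt {m : ℕ} (x y : ZMod m) : Fin 3 → ZMod m := ![x, y, -x - y]

theorem eq_layerPt {m : ℕ} {v : Fin 3 → ZMod m} (h : v 0 + v 1 + v 2 = 0) :
    v = layerPt (v 0) (v 1) := by
  funext i
  fin_cases i
  · rfl
  · rfl
  · change v 2 = -v 0 - v 1
    linear_combination h

theorem sum_next {m : ℕ} (w : Fin 3 → ZMod m) :
    next w 0 + next w 1 + next w 2 = w 0 + w 1 + w 2 + 1 := by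
  simp only [next, Pi.add_apply]
  generalize dir w = d
  fin_cases d <;> simp <;> ring

theorem natCast_ne_zero_of_lt {m r : ℕ} (h0 : 0 < r) (h : r < m) : (r : ZMod m) ≠ 0 := fun e =>
  absurd (Nat.le_of_dvd h0 ((ZMod.natCast_eq_zero_iff r m).1 e)) (by omega)

/-- The sum is `r` steps short of 0, and `r + 2 ≤ m` keeps it away from 0 and 1 until then, so every
step is along axis 2. -/
theorem reaches_run {m : ℕ} (r : ℕ) : ∀ (v : Fin 3 → ZMod m), r + 2 ≤ m →
    v 0 + v 1 + v 2 = -(r : ZMod m) → Reaches v (v + Pi.single 2 (r : ZMod m)) := by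
  induction r with
  | zero => intro v _ _; simpa using Reaches.refl v
  | succ r ih =>
    intro v hr hv
    have hd : dir v = 2 := by
      have h0 : v 0 + v 1 + v 2 ≠ 0 := by
        rw [hv, neg_ne_zero]
        exact natCast_ne_zero_of_lt (by omega) (by omega)
      have h1 : v 0 + v 1 + v 2 ≠ 1 := by
        rw [hv]
        intro h
        refine natCast_ne_zero_of_lt (m := m) (r := r + 2) (by omega) (by omega) ?_
        push_cast at h ⊢
        linear_combination -h
      simp [dir, h0, h1]
    have hn : next v = v + Pi.single 2 1 := by rw [next, hd]
    refine (reaches_next v).trans ?_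
    have := ih (next v) (by omega) (by rw [sum_next, hv]; push_cast; ring)
    convert this using 1
    rw [hn, add_assoc, ← Pi.single_add]
    push_cast
    rw [add_comm (1 : ZMod m)]

/-- Going once around through the layers. -/
theorem reaches_layerPt {m : ℕ} (hm : 4 ≤ m) (x y : ZMod m) :
    Reaches (layerPt x y)
      (layerPt (x + if layerDir x y (-x - y) = 0 then 1 else 0)
        (y + (if layerDir x y (-x - y) = 1 then 1 else 0) + 1)) := by
  have : Fact (1 < m) := ⟨by omega⟩
  set d := layerDir x y (-x - y) with hd
  have h0 : dir (layerPt x y) = d := by simp [dir, layerPt, hd]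
  have hs0 : layerPt x y 0 + layerPt x y 1 + layerPt x y 2 = 0 := by simp [layerPt]
  have h1 : dir (next (layerPt x y)) = 1 := by
    simp [dir, sum_next, hs0]
  set w := next (next (layerPt x y)) with hw
  -- After two steps the sum is 2 = -(m - 2), leaving a run of m - 2 steps along axis 2.
  have hsw : w 0 + w 1 + w 2 = -((m - 2 : ℕ) : ZMod m) := by
    rw [hw, sum_next, sum_next, hs0, Nat.cast_sub (by omega)]
    simp; norm_num
  refine ((reaches_next _).trans ((reaches_next _).trans
    (reaches_run (m - 2) w (by omega) hsw))).trans ?_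
  have hw' : w = layerPt x y + Pi.single d 1 + Pi.single 1 1 := by
    rw [hw, next, h1, next, h0]
  obtain ⟨u, hu⟩ : ∃ u : Fin 3 → ZMod m, u = w + Pi.single 2 ((m - 2 : ℕ) : ZMod m) := ⟨_, rfl⟩
  have hsu : u 0 + u 1 + u 2 = 0 := by
    rw [hu]
    simp only [Pi.add_apply]
    simp
    linear_combination hsw
  have e0 : u 0 = x + if d = 0 then 1 else 0 := by
    rw [hu, hw']
    simp only [Pi.add_apply]
    generalize d = d
    fin_cases d <;> simp [layerPt]
  have e1 : u 1 = y + (if d = 1 then 1 else 0) + 1 := by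
    rw [hu, hw']
    simp only [Pi.add_apply]
    generalize d = d
    fin_cases d <;> simp [layerPt]
  rw [← hu, eq_layerPt hsu, e0, e1]
  exact Reaches.refl _

/-! ### The return map in natural number coordinates -/

/-- Vertices of the layer `x + y + z = 0` with natural number coordinates. -/
def natPt (m a b : ℕ) : Fin 3 → ZMod m := layerPt (a : ZMod m) (b : ZMod m)

theorem reaches_natPt {m : ℕ} (hm : 4 ≤ m) (a b : ℕ) (d : Fin 3)
    (hd : layerDir (a : ZMod m) b (-a - b) = d) :
    Reaches (natPt m a b) (natPt m (a + if d = 0 then 1 else 0)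
      (b + (if d = 1 then 1 else 0) + 1)) := by
  have := reaches_layerPt hm (a : ZMod m) b
  rw [hd] at this
  simpa [natPt] using this

/-- The first coordinate may run up to 2m, so that diagonals need not be cut where they wrap; sums a
+ b then stay below 3m. -/
theorem natCast_eq_zero_iff_of_lt {m a : ℕ} (h : a < 3 * m) :
    (a : ZMod m) = 0 ↔ a = 0 ∨ a = m ∨ a = 2 * m := by
  rw [ZMod.natCast_eq_zero_iff]
  constructor
  · rintro ⟨k, rfl⟩
    have : k < 3 := by
      by_contra hk
      have := Nat.mul_le_mul_left m (show 3 ≤ k by omega)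
      omega
    interval_cases k <;> omega
  · rintro (rfl | rfl | rfl) <;> simp

/-- The direction at a vertex of the layer `x + y + z = 0` in natural number coordinates. -/
theorem layerDir_natCast {m : ℕ} (hm : 4 ≤ m) {a b : ℕ} (ha : a < 2 * m) (hb : b < m) :
    layerDir (a : ZMod m) b (-a - b) =
      if b = 0 then if a = 0 ∨ a = m then 0 else if a = 1 ∨ a = m + 1 then 1 else 2
      else if a + b = m ∨ a + b = 2 * m then if a = 1 ∨ a = m + 1 then 2 else 1
      else if a = 0 ∨ a = m then if b = 1 then 2 else if b = m - 1 then 1 else 0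
      else 0 := by
  have hx : (a : ZMod m) = 0 ↔ a = 0 ∨ a = m := by
    rw [natCast_eq_zero_iff_of_lt (by omega)]; omega
  have hy : (b : ZMod m) = 0 ↔ b = 0 := by
    rw [natCast_eq_zero_iff_of_lt (by omega)]; omega
  have hz : (-a - b : ZMod m) = 0 ↔ a + b = 0 ∨ a + b = m ∨ a + b = 2 * m := by
    rw [← natCast_eq_zero_iff_of_lt (m := m) (by omega)]
    push_cast
    constructor <;> intro h <;> linear_combination -h
  have hx1 : (a : ZMod m) = 1 ↔ a = 1 ∨ a = m + 1 := by
    have h : ((a + (m - 1) : ℕ) : ZMod m) = 0 ↔ (a : ZMod m) = 1 := by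
      rw [Nat.cast_add, Nat.cast_sub (by omega)]
      constructor <;> intro h
      · simp at h; linear_combination h
      · simp; linear_combination h
    rw [← h, natCast_eq_zero_iff_of_lt (by omega)]; omega
  have hy1 : (b : ZMod m) = 1 ↔ b = 1 := by
    have h : ((b + (m - 1) : ℕ) : ZMod m) = 0 ↔ (b : ZMod m) = 1 := by
      rw [Nat.cast_add, Nat.cast_sub (by omega)]
      constructor <;> intro h
      · simp at h; linear_combination h
      · simp; linear_combination h
    rw [← h, natCast_eq_zero_iff_of_lt (by omega)]; omega
  have hz1 : (a = 0 ∨ a = m) → ((-a - b : ZMod m) = 1 ↔ b = m - 1) := by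
    intro h
    rw [← hx] at h
    have h' : ((b + 1 : ℕ) : ZMod m) = 0 ↔ (-a - b : ZMod m) = 1 := by
      push_cast
      rw [h]
      constructor <;> intro h <;> linear_combination -h
    rw [← h', natCast_eq_zero_iff_of_lt (by omega)]; omega
  unfold layerDir
  simp only [hx, hy, hz, hx1, hy1]
  by_cases h : a = 0 ∨ a = m
  · simp only [hz1 h]
    grind
  · grind

/-- Axes 1, 2 and 0 on the layer give the return moves (0,2), (0,1) and (1,1), because layer 1
always contributes one more step in y. This lemma and the next two record the cases needed below. -/
theorem reaches_up_two {m a b : ℕ} (hm : 4 ≤ m) (ha : a < 2 * m) (hb : b < m)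
    (h : (b = 0 ∧ a = 1) ∨ (0 < b ∧ (a + b = m ∨ a + b = 2 * m) ∧ a ≠ 1 ∧ a ≠ m + 1) ∨
      (a = 0 ∧ b = m - 1)) :
    Reaches (natPt m a b) (natPt m a (b + 2)) := by
  have := reaches_natPt hm a b 1 (by rw [layerDir_natCast hm ha hb]; grind)
  simpa using this

theorem reaches_up_one {m a b : ℕ} (hm : 4 ≤ m) (ha : a < 2 * m) (hb : b < m)
    (h : (b = 0 ∧ 1 < a ∧ a < m) ∨ ((a = 1 ∨ a = m + 1) ∧ b = m - 1) ∨ (a = 0 ∧ b = 1)) :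
    Reaches (natPt m a b) (natPt m a (b + 1)) := by
  have := reaches_natPt hm a b 2 (by rw [layerDir_natCast hm ha hb]; grind)
  simpa using this

theorem reaches_diag_one {m a b : ℕ} (hm : 4 ≤ m) (ha : a < 2 * m) (hb : b < m)
    (h : (0 < b ∧ a + b ≠ m ∧ a + b ≠ 2 * m ∧
      ¬ ((a = 0 ∨ a = m) ∧ (b = 1 ∨ b = m - 1))) ∨ (a = 0 ∧ b = 0)) :
    Reaches (natPt m a b) (natPt m (a + 1) (b + 1)) := by
  have := reaches_natPt hm a b 0 (by rw [layerDir_natCast hm ha hb]; grind)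
  simpa using this

theorem reaches_diag {m : ℕ} (hm : 4 ≤ m) (k a b : ℕ)
    (h : ∀ j < k, a + j < 2 * m ∧ 0 < b + j ∧ b + j < m ∧ a + j + (b + j) ≠ m ∧
      a + j + (b + j) ≠ 2 * m ∧ ¬ ((a + j = 0 ∨ a + j = m) ∧ (b + j = 1 ∨ b + j = m - 1))) :
    Reaches (natPt m a b) (natPt m (a + k) (b + k)) := by
  induction k with
  | zero => exact Reaches.refl _
  | succ k ih =>
    refine (ih fun j hj => h j (by omega)).trans ?_
    have := h k (by omega)
    exact reaches_diag_one hm this.1 this.2.2.1 (Or.inl (by omega))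

theorem natPt_eq {m a b a' b' : ℕ} (ha : a = a' ∨ a = a' + m) (hb : b = b' ∨ b = b' + m) :
    natPt m a b = natPt m a' b' := by
  rcases ha with rfl | rfl <;> rcases hb with rfl | rfl <;> simp [natPt]

theorem Reaches.congr {m a b a' b' c d c' d' : ℕ} (h : Reaches (natPt m a b) (natPt m c d))
    (ha : a = a' ∨ a = a' + m) (hb : b = b' ∨ b = b' + m)
    (hc : c = c' ∨ c = c' + m) (hd : d = d' ∨ d = d' + m) :
    Reaches (natPt m a' b') (natPt m c' d') := by
  rwa [natPt_eq ha hb, natPt_eq hc hd] at h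

/-! ### First returns to the row y = 0 -/

/-- An even coordinate `x ≥ 4` of the row `y = 0` is followed by `x - 1`. -/
theorem reaches_row_even {p q : ℕ} (hq : 2 ≤ q) (hqp : q < p) :
    Reaches (natPt (2 * p) (2 * q) 0) (natPt (2 * p) (2 * q - 1) 0) := by
  have h1 := reaches_up_one (m := 2 * p) (a := 2 * q) (b := 0) (by omega) (by omega) (by omega)
    (by omega)
  -- The sum a + b is now odd, and diagonal moves keep its parity. As m is even, the diagonal never
  -- meets a + b = m or 2m.
  have h2 := reaches_diag (m := 2 * p) (by omega) (2 * p - 1) (2 * q) (0 + 1)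
    (fun j hj => by omega)
  have h := h1.trans h2
  exact h.congr (by omega) (by omega) (by omega) (by omega)

/-- From an odd coordinate `x ≥ 3` of the row `y = 0` to the second crossing of `x + y = 0`. -/
theorem reaches_row_odd_aux {p q : ℕ} (hq : 1 ≤ q) (hqp : q < p) :
    Reaches (natPt (2 * p) (2 * q + 1) 0) (natPt (2 * p) (2 * p + q - 1) (2 * p + 1 - q)) := by
  have h1 := reaches_up_one (m := 2 * p) (a := 2 * q + 1) (b := 0) (by omega) (by omega)
    (by omega) (by omega)
  -- Here a + b is even: the diagonal hits a + b = m, jumps up by 2, and hits a + b = 2m after p - 1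
  -- more moves.
  have h2 := reaches_diag (m := 2 * p) (by omega) (p - 1 - q) (2 * q + 1) (0 + 1)
    (fun j hj => by omega)
  have h3 := reaches_up_two (m := 2 * p) (a := 2 * q + 1 + (p - 1 - q))
    (b := 0 + 1 + (p - 1 - q)) (by omega) (by omega) (by omega) (by omega)
  have h4 := reaches_diag (m := 2 * p) (by omega) (p - 1) (2 * q + 1 + (p - 1 - q))
    (0 + 1 + (p - 1 - q) + 2) (fun j hj => by omega)
  convert ((h1.trans h2).trans h3).trans h4 using 2 <;> omega

/-- An odd coordinate `x ≥ 7` of the row `y = 0` is followed by `x - 5`. -/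
theorem reaches_row_odd {p q : ℕ} (hq : 3 ≤ q) (hqp : q < p) :
    Reaches (natPt (2 * p) (2 * q + 1) 0) (natPt (2 * p) (2 * q - 4) 0) := by
  have h1 := reaches_row_odd_aux (p := p) (q := q) (by omega) hqp
  have h2 := reaches_up_two (m := 2 * p) (a := 2 * p + q - 1) (b := 2 * p + 1 - q) (by omega)
    (by omega) (by omega) (by omega)
  have h3 := reaches_diag (m := 2 * p) (by omega) (q - 3) (2 * p + q - 1) (2 * p + 1 - q + 2)
    (fun j hj => by omega)
  have h := (h1.trans h2).trans h3
  exact h.congr (by omega) (by omega) (by omega) (by omega)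

/-- For q = 1 the second crossing already lies on the row y = 0. -/
theorem reaches_row_three {p : ℕ} (hp : 2 ≤ p) :
    Reaches (natPt (2 * p) 3 0) (natPt (2 * p) 0 0) := by
  have h := reaches_row_odd_aux (p := p) (q := 1) (by omega) (by omega)
  exact h.congr (by omega) (by omega) (by omega) (by omega)

/-- For q = 2 the second crossing has x ≡ 1, where the jump is 1 instead of 2. -/
theorem reaches_row_five {p : ℕ} (hp : 3 ≤ p) :
    Reaches (natPt (2 * p) 5 0) (natPt (2 * p) 1 0) := by
  have h1 := reaches_row_odd_aux (p := p) (q := 2) (by omega) (by omega)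
  have h2 := reaches_up_one (m := 2 * p) (a := 2 * p + 2 - 1) (b := 2 * p + 1 - 2) (by omega)
    (by omega) (by omega) (by omega)
  have h := h1.trans h2
  exact h.congr (by omega) (by omega) (by omega) (by omega)

theorem reaches_row_one {p : ℕ} (hp : 2 ≤ p) :
    Reaches (natPt (2 * p) 1 0) (natPt (2 * p) (2 * p - 1) 0) := by
  have h1 := reaches_up_two (m := 2 * p) (a := 1) (b := 0) (by omega) (by omega) (by omega)
    (by omega)
  have h2 := reaches_diag (m := 2 * p) (by omega) (2 * p - 2) 1 (0 + 2) (fun j hj => by omega)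
  have h := h1.trans h2
  exact h.congr (by omega) (by omega) (by omega) (by omega)

/-- The vertex `(0, 1)` comes before the coordinate `m - 4` of the row `y = 0`. -/
theorem reaches_exceptional {p : ℕ} (hp : 3 ≤ p) :
    Reaches (natPt (2 * p) 0 1) (natPt (2 * p) (2 * p - 4) 0) := by
  have h1 := reaches_up_one (m := 2 * p) (a := 0) (b := 1) (by omega) (by omega) (by omega)
    (by omega)
  have h2 := reaches_diag (m := 2 * p) (by omega) (p - 1) 0 (1 + 1) (fun j hj => by omega)
  have h3 := reaches_up_two (m := 2 * p) (a := 0 + (p - 1)) (b := 1 + 1 + (p - 1)) (by omega)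
    (by omega) (by omega) (by omega)
  have h4 := reaches_diag (m := 2 * p) (by omega) (p - 3) (0 + (p - 1)) (1 + 1 + (p - 1) + 2)
    (fun j hj => by omega)
  have h := ((h1.trans h2).trans h3).trans h4
  exact h.congr (by omega) (by omega) (by omega) (by omega)

/-- The odd diagonal runs into the exceptional point (0, m - 1), which jumps over the row y = 0 to
(0, 1). -/
theorem reaches_row_two {p : ℕ} (hp : 3 ≤ p) :
    Reaches (natPt (2 * p) 2 0) (natPt (2 * p) (2 * p - 4) 0) := by
  have h1 := reaches_up_one (m := 2 * p) (a := 2) (b := 0) (by omega) (by omega) (by omega)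
    (by omega)
  have h2 := reaches_diag (m := 2 * p) (by omega) (2 * p - 2) 2 (0 + 1) (fun j hj => by omega)
  have h := (h1.trans h2).congr (a' := 2) (b' := 0) (c' := 0) (d' := 0 + 1 + (2 * p - 2))
    (by omega) (by omega) (by omega) (by omega)
  have h3 := reaches_up_two (m := 2 * p) (a := 0) (b := 0 + 1 + (2 * p - 2)) (by omega)
    (by omega) (by omega) (by omega)
  have h' := (h.trans h3).congr (a' := 2) (b' := 0) (c' := 0) (d' := 1)
    (by omega) (by omega) (by omega) (by omega)
  exact h'.trans (reaches_exceptional hp)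

/-! ### All orbits reach the origin -/

/-- Every vertex of the row `y = 0` reaches the origin. -/
theorem row_reaches_origin {p : ℕ} (hp : 5 ≤ p) (hmod : p % 3 = 2) (a : ℕ) (ha : a < 2 * p) :
    Reaches (natPt (2 * p) a 0) (natPt (2 * p) 0 0) := by
  have h3 := reaches_row_three (p := p) (by omega)
  -- Each class of even coordinates modulo 6 descends by x → x - 1 → x - 6; this one ends in 4 → 3 →
  -- 0.
  have hclass4 : ∀ t, 6 * t + 4 < 2 * p → Reaches (natPt (2 * p) (6 * t + 4) 0)
      (natPt (2 * p) 0 0) := by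
    intro t
    induction t with
    | zero =>
      intro _
      exact (reaches_row_even (p := p) (q := 2) (by omega) (by omega)).trans h3
    | succ t ih =>
      intro ht
      have h1 := reaches_row_even (p := p) (q := 3 * t + 5) (by omega) (by omega)
      have h2 := (reaches_row_odd (p := p) (q := 3 * t + 4) (by omega) (by omega)).congr
        (a' := 2 * (3 * t + 5) - 1) (b' := 0) (c' := 6 * t + 4) (d' := 0)
        (by omega) (by omega) (by omega) (by omega)
      exact ((h1.trans h2).trans (ih (by omega))).congr
        (by omega) (by omega) (by omega) (by omega)
  have h1 : Reaches (natPt (2 * p) 1 0) (natPt (2 * p) 0 0) := by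
    have h := (reaches_row_one (p := p) (by omega)).trans
      ((reaches_row_odd (p := p) (q := p - 1) (by omega) (by omega)).congr
        (a' := 2 * p - 1) (b' := 0) (c' := 2 * p - 6) (d' := 0)
        (by omega) (by omega) (by omega) (by omega))
    -- The orbit runs 1 → m - 1 → m - 6, and m - 6 ≡ 4 mod 6.
    exact h.trans ((hclass4 ((2 * p - 10) / 6) (by omega)).congr
      (by omega) (by omega) (by omega) (by omega))
  have h5 := (reaches_row_five (p := p) (by omega)).trans h1
  have hclass0 : ∀ t, 6 * t < 2 * p → Reaches (natPt (2 * p) (6 * t) 0)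
      (natPt (2 * p) 0 0) := by
    intro t
    induction t with
    | zero => intro _; exact Reaches.refl _
    | succ t ih =>
      intro ht
      have h1 := reaches_row_even (p := p) (q := 3 * t + 3) (by omega) (by omega)
      rcases Nat.eq_zero_or_pos t with rfl | htpos
      · exact h1.trans h5
      have h2 := (reaches_row_odd (p := p) (q := 3 * t + 2) (by omega) (by omega)).congr
        (a' := 2 * (3 * t + 3) - 1) (b' := 0) (c' := 6 * t) (d' := 0)
        (by omega) (by omega) (by omega) (by omega)
      exact ((h1.trans h2).trans (ih (by omega))).congr
        (by omega) (by omega) (by omega) (by omega)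
  have h2 : Reaches (natPt (2 * p) 2 0) (natPt (2 * p) 0 0) := by
    -- Here 2 → m - 4, and m - 4 ≡ 0 mod 6.
    exact (reaches_row_two (p := p) (by omega)).trans ((hclass0 ((2 * p - 4) / 6)
      (by omega)).congr (by omega) (by omega) (by omega) (by omega))
  have hclass2 : ∀ t, 6 * t + 2 < 2 * p → Reaches (natPt (2 * p) (6 * t + 2) 0)
      (natPt (2 * p) 0 0) := by
    intro t
    induction t with
    | zero => intro _; exact h2
    | succ t ih =>
      intro ht
      have h1 := reaches_row_even (p := p) (q := 3 * t + 4) (by omega) (by omega)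
      have h2 := (reaches_row_odd (p := p) (q := 3 * t + 3) (by omega) (by omega)).congr
        (a' := 2 * (3 * t + 4) - 1) (b' := 0) (c' := 6 * t + 2) (d' := 0)
        (by omega) (by omega) (by omega) (by omega)
      exact ((h1.trans h2).trans (ih (by omega))).congr
        (by omega) (by omega) (by omega) (by omega)
  have heven : ∀ q < p, Reaches (natPt (2 * p) (2 * q) 0) (natPt (2 * p) 0 0) := by
    intro q hq
    obtain h | h | h : q % 3 = 0 ∨ q % 3 = 1 ∨ q % 3 = 2 := by omega
    · exact (hclass0 (q / 3) (by omega)).congr (by omega) (by omega) (by omega) (by omega)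
    · exact (hclass2 (q / 3) (by omega)).congr (by omega) (by omega) (by omega) (by omega)
    · exact (hclass4 (q / 3) (by omega)).congr (by omega) (by omega) (by omega) (by omega)
  obtain ⟨q, rfl | rfl⟩ : ∃ q, a = 2 * q ∨ a = 2 * q + 1 := ⟨a / 2, by omega⟩
  · exact heven q (by omega)
  · rcases Nat.lt_or_ge q 3 with h | h
    · interval_cases q
      · exact h1
      · exact h3
      · exact h5
    · refine (reaches_row_odd (p := p) h (by omega)).trans ?_
      exact (heven (q - 2) (by omega)).congr (by omega) (by omega) (by omega) (by omega)

/-- Every vertex of the layer `x + y + z = 0` reaches the origin. -/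
theorem layer_reaches_origin {p : ℕ} (hp : 5 ≤ p) (hmod : p % 3 = 2) (c : ℕ) :
    ∀ a b : ℕ, a < 2 * p → b < 2 * p → 2 * p ≤ b + c →
      Reaches (natPt (2 * p) a b) (natPt (2 * p) 0 0) := by
  have hrow := row_reaches_origin hp hmod
  induction c with
  | zero => intro a b _ _ _; omega
  | succ c ih =>
    intro a b ha hb hc
    rcases Nat.eq_zero_or_pos b with rfl | hb0
    · exact hrow a ha
    -- Return moves raise b, and b = m is the row y = 0; the induction is on a bound for m - b. Only
    -- (0, m - 1) overshoots that row, and it is treated apart.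
    have key : ∀ a' b', a' < 2 * p → b < b' → b' ≤ 2 * p →
        Reaches (natPt (2 * p) a' b') (natPt (2 * p) 0 0) := by
      intro a' b' ha' hb' hb''
      rcases Nat.lt_or_ge b' (2 * p) with h | h
      · exact ih a' b' ha' h (by omega)
      · rw [natPt_eq (a' := a') (b' := 0) (by omega) (by omega)]
        exact hrow a' ha'
    by_cases h1 : (a = 1 ∧ b = 2 * p - 1) ∨ (a = 0 ∧ b = 1)
    · exact (reaches_up_one (by omega) (by omega) hb (by omega)).trans
        (key a (b + 1) ha (by omega) (by omega))
    by_cases h2 : a = 0 ∧ b = 2 * p - 1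
    · obtain ⟨rfl, rfl⟩ := h2
      have h := reaches_up_two (m := 2 * p) (a := 0) (b := 2 * p - 1) (by omega) (by omega)
        (by omega) (by omega)
      have h' := h.congr (a' := 0) (b' := 2 * p - 1) (c' := 0) (d' := 1)
        (by omega) (by omega) (by omega) (by omega)
      exact (h'.trans (reaches_exceptional (by omega))).trans (hrow _ (by omega))
    by_cases h3 : a + b = 2 * p
    · exact (reaches_up_two (by omega) (by omega) hb (by omega)).trans
        (key a (b + 2) ha (by omega) (by omega))
    refine (reaches_diag_one (by omega) (by omega) hb (by omega)).trans ?_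
    rcases Nat.lt_or_ge (a + 1) (2 * p) with h | h
    · exact key (a + 1) (b + 1) h (by omega) (by omega)
    · rw [natPt_eq (a' := 0) (b' := b + 1) (by omega) (by omega)]
      exact key _ (b + 1) (by omega) (by omega) (by omega)

/-- Every vertex reaches the layer `x + y + z = 0`. -/
theorem exists_reaches_layerPt {m : ℕ} (hm : 4 ≤ m) (v : Fin 3 → ZMod m) :
    ∃ x y, Reaches v (layerPt x y) := by
  have : NeZero m := ⟨by omega⟩
  have key : ∀ r ≤ m, ∀ v : Fin 3 → ZMod m, v 0 + v 1 + v 2 = -(r : ZMod m) →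
      ∃ x y, Reaches v (layerPt x y) := by
    intro r
    induction r with
    | zero =>
      intro _ v hv
      rw [Nat.cast_zero, neg_zero] at hv
      exact ⟨v 0, v 1, 0, eq_layerPt hv⟩
    | succ r ih =>
      intro hr v hv
      obtain ⟨x, y, h⟩ := ih (by omega) (next v) (by rw [sum_next, hv]; push_cast; ring)
      exact ⟨x, y, (reaches_next v).trans h⟩
  refine key (-(v 0 + v 1 + v 2)).val (ZMod.val_lt _).le v ?_
  rw [ZMod.natCast_zmod_val]
  ring

theorem reaches_zero_of_ten_le {m : ℕ} (hm : 10 ≤ m) (hmod : m % 6 = 4) (v : Fin 3 → ZMod m) :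
    Reaches v 0 := by
  have : NeZero m := ⟨by omega⟩
  obtain ⟨p, rfl⟩ : ∃ p, m = 2 * p := ⟨m / 2, by omega⟩
  obtain ⟨x, y, h⟩ := exists_reaches_layerPt (by omega) v
  refine h.trans ?_
  have := layer_reaches_origin (p := p) (by omega) (by omega) (2 * p) x.val y.val
    (ZMod.val_lt _) (ZMod.val_lt _) (by omega)
  have h0 : natPt (2 * p) 0 0 = 0 := by
    funext i
    fin_cases i <;> simp [natPt, layerPt]
  rwa [h0, natPt, ZMod.natCast_zmod_val, ZMod.natCast_zmod_val] at this

theorem reaches_zero_four (v : Fin 3 → ZMod 4) : Reaches v 0 := by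
  obtain ⟨x, y, h⟩ := exists_reaches_layerPt le_rfl v
  refine h.trans ?_
  -- Every fourth step returns to the layer, which has 16 points.
  have : ∀ x y : ZMod 4, ∃ k < 16, next^[4 * k] (layerPt x y) = 0 := by decide +kernel
  obtain ⟨k, -, hk⟩ := this x y
  exact ⟨_, hk⟩

theorem reaches_zero {m : ℕ} (hmod : m % 6 = 4) (v : Fin 3 → ZMod m) : Reaches v 0 := by
  rcases Nat.lt_or_ge m 10 with h | h
  · obtain rfl : m = 4 := by omega
    exact reaches_zero_four v
  · exact reaches_zero_of_ten_le h hmod v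

/-- The successor permutation of the source cycle of `torus m 3`. -/
noncomputable def nextPerm {m : ℕ} [NeZero m] (hm : 4 ≤ m) : Equiv.Perm (Fin 3 → ZMod m) :=
  Equiv.ofBijective next (Finite.injective_iff_bijective.1 (next_injective hm))

theorem nextPerm_isCycleOn {m : ℕ} [NeZero m] (hm : 4 ≤ m) (hmod : m % 6 = 4) :
    (nextPerm hm).IsCycleOn (Finset.univ : Finset (Fin 3 → ZMod m)) := by
  refine ⟨by simp, ?_⟩
  have key : ∀ v, (nextPerm hm).SameCycle v 0 := fun v => by
    obtain ⟨k, hk⟩ := reaches_zero hmod v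
    refine ⟨k, ?_⟩
    rw [zpow_natCast, Equiv.Perm.coe_pow]
    exact hk
  intro u _ v _
  exact (key u).trans (key v).symm

/-! ### Three blocks: from `torus m 3` to `torus 4 (3 * n)` -/

/-- Gluing three points of `torus 4 n` to a point of `torus 4 (3 * n)`. -/
def glue (n : ℕ) : (Fin 3 → Fin n → ZMod 4) ≃ (Fin (3 * n) → ZMod 4) :=
  (Equiv.curry (Fin 3) (Fin n) (ZMod 4)).symm.trans (finProdFinEquiv.arrowCongr (Equiv.refl _))

theorem glue_apply {n : ℕ} (X : Fin 3 → Fin n → ZMod 4) (l : Fin 3) (p : Fin n) :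
    glue n X (finProdFinEquiv (l, p)) = X l p := by
  simp [glue, Equiv.arrowCongr]

theorem glue_adj {n : ℕ} (X Y : Fin 3 → Fin n → ZMod 4) :
    (torus 4 (3 * n)).Adj (glue n X) (glue n Y) ↔
      ∃ l, (torus 4 n).Adj (X l) (Y l) ∧ ∀ l', l' ≠ l → X l' = Y l' := by
  constructor
  · rintro ⟨k, h1, h2, h3⟩
    obtain ⟨⟨l, p⟩, rfl⟩ := finProdFinEquiv.surjective k
    simp only [glue_apply] at h1 h2
    have h : ∀ l' p', (l', p') ≠ (l, p) → X l' p' = Y l' p' := fun l' p' hne => by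
      have := h3 (finProdFinEquiv (l', p')) (fun e => hne (finProdFinEquiv.injective e))
      simpa only [glue_apply] using this
    exact ⟨l, ⟨p, h1, h2, fun j hj => h l j (by simpa using hj)⟩,
      fun l' hl' => funext fun j => h l' j (by simp [hl'])⟩
  · rintro ⟨l, ⟨p, h1, h2, h3⟩, h⟩
    refine ⟨finProdFinEquiv (l, p), ?_, ?_, fun k hk => ?_⟩
    · simpa only [glue_apply] using h1
    · simpa only [glue_apply] using h2
    · obtain ⟨⟨l', p'⟩, rfl⟩ := finProdFinEquiv.surjective k
      simp only [glue_apply]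
      by_cases hl : l' = l
      · subst hl
        exact h3 p' (fun e => hk (by rw [e]))
      · rw [h l' hl]

/-- The product of a shift of the three blocks and a permutation inside the blocks. -/
def blockPerm {n : ℕ} (j : Fin 3) (τ : Equiv.Perm (Fin n)) : Equiv.Perm (Fin (3 * n)) :=
  finProdFinEquiv.permCongr ((Equiv.addRight j).prodCongr τ)

theorem blockPerm_apply {n : ℕ} (j : Fin 3) (τ : Equiv.Perm (Fin n)) (l : Fin 3) (p : Fin n) :
    blockPerm j τ (finProdFinEquiv (l, p)) = finProdFinEquiv (l + j, τ p) := by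
  simp [blockPerm, Equiv.permCongr_apply]

theorem axisIso_blockPerm {n : ℕ} (j : Fin 3) (τ : Equiv.Perm (Fin n))
    (X : Fin 3 → Fin n → ZMod 4) :
    axisIso (blockPerm j τ) (glue n X) = glue n fun l => axisIso τ (X (l - j)) := by
  funext k
  obtain ⟨⟨l, p⟩, rfl⟩ := finProdFinEquiv.surjective k
  rw [glue_apply]
  change glue n X ((blockPerm j τ).symm (finProdFinEquiv (l, p))) = X (l - j) (τ.symm p)
  rw [← glue_apply X]
  refine congrArg (glue n X) ((Equiv.symm_apply_eq _).2 ?_)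
  rw [blockPerm_apply]
  simp

/-- The product of the Latin family of the three shifts with a Latin family. -/
def blockFamily {n : ℕ} (σ : Fin n → Equiv.Perm (Fin n)) (k : Fin (3 * n)) :
    Equiv.Perm (Fin (3 * n)) :=
  blockPerm (finProdFinEquiv.symm k).1 (σ (finProdFinEquiv.symm k).2)

theorem IsLatinFamily.blockFamily {n : ℕ} {σ : Fin n → Equiv.Perm (Fin n)}
    (hσ : IsLatinFamily σ) : IsLatinFamily (blockFamily σ) where
  column k := by
    rw [← Finite.injective_iff_bijective]
    intro a b hab
    obtain ⟨⟨l, p⟩, rfl⟩ := finProdFinEquiv.surjective k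
    obtain ⟨⟨j, i⟩, rfl⟩ := finProdFinEquiv.surjective a
    obtain ⟨⟨j', i'⟩, rfl⟩ := finProdFinEquiv.surjective b
    simp only [HypercubeHD.blockFamily, Equiv.symm_apply_apply, blockPerm_apply,
      EmbeddingLike.apply_eq_iff_eq, Prod.mk.injEq, add_right_inj] at hab
    rw [hab.1, (hσ.column p).1 hab.2]
  first k hk := by
    obtain ⟨⟨j, i⟩, rfl⟩ := finProdFinEquiv.surjective k
    simp only [finProdFinEquiv_apply_val] at hk
    have hn : 0 < n := i.pos
    have hi : (i : ℕ) = 0 := by omega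
    have hj : j = 0 := by
      have : n * (j : ℕ) = 0 := by omega
      exact Fin.ext ((Nat.mul_eq_zero.1 this).resolve_left hn.ne')
    ext x
    obtain ⟨⟨l, p⟩, rfl⟩ := finProdFinEquiv.surjective x
    simp [HypercubeHD.blockFamily, blockPerm_apply, hσ.first i hi, hj]

/-- The neighbour of `w` in the positive direction of the axis `a`. -/
abbrev bump {m : ℕ} (w : Fin 3 → ZMod m) (a : Fin 3) : Fin 3 → ZMod m := w + Pi.single a 1

/-- A source cycle in quaternary coordinates comes from one of the hypercube. -/
theorem hasSourceCycle_of_torus {n : ℕ} {v : Fin n → ZMod 4} (W : (torus 4 n).Walk v v)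
    (hW : IsSourceCycle W) (hv : v = (quaternary n).toHom fun _ => false) : HasSourceCycle n := by
  subst hv
  refine ⟨(W.map (quaternary n).symm.toHom).copy ((quaternary n).symm_apply_apply _)
    ((quaternary n).symm_apply_apply _), ?_⟩
  suffices h : ((W.map (quaternary n).symm.toHom).copy ((quaternary n).symm_apply_apply _)
      ((quaternary n).symm_apply_apply _)).map (quaternary n).toHom = W by rwa [h]
  -- Comparing vertex lists avoids the endpoint casts.
  apply SimpleGraph.Walk.ext_support
  rw [SimpleGraph.Walk.support_map, SimpleGraph.Walk.support_copy,
    SimpleGraph.Walk.support_map, List.map_map]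
  convert List.map_id _
  funext x
  exact (quaternary n).apply_symm_apply x

/-- If the cycles `C i` have disjoint edges, then an edge of `torus 4 (3 * n)` comes from at most one
edge of at most one of the products `C i × C i × C i`. -/
theorem glue_edges_disjoint {n m : ℕ} (hm : 4 ≤ m) (C : Fin n → ZMod m ≃ (Fin n → ZMod 4))
    (hdisj : ∀ i i' t t', s(C i t, C i (t + 1)) = s(C i' t', C i' (t' + 1)) → i = i')
    {i i' : Fin n} {a b : Fin 3} {w u : Fin 3 → ZMod m}
    (h : s(glue n fun l => C i (w l), glue n fun l => C i (bump w a l)) =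
      s(glue n fun l => C i' (u l), glue n fun l => C i' (bump u b l))) :
    i = i' ∧ a = b ∧ w = u := by
  have : Fact (1 < m) := ⟨by omega⟩
  have hsucc : ∀ t : ZMod m, t ≠ t + 1 := by simp
  rcases Sym2.eq_iff.1 h with ⟨h1, h2⟩ | ⟨h1, h2⟩
  · have h1 := fun l => congrFun ((glue n).injective h1) l
    have h2 := fun l => congrFun ((glue n).injective h2) l
    -- The moving block can be read off from the two endpoints.
    have hab : a = b := by
      by_contra hab
      have e1 := h1 a
      have e2 := h2 a
      simp only [Pi.add_apply, Pi.single_eq_same, Pi.single_eq_of_ne hab, add_zero] at e2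
      exact hsucc _ ((C i).injective (e1.trans e2.symm))
    subst hab
    have e1 := h1 a
    have e2 := h2 a
    simp only [Pi.add_apply, Pi.single_eq_same] at e2
    obtain rfl := hdisj i i' (w a) (u a) (by rw [e1, e2])
    exact ⟨rfl, rfl, funext fun l => (C i).injective (h1 l)⟩
  -- Opposite orientations in the same block of the same cycle would give 2 = 0 modulo m.
  · exfalso
    have h1 := fun l => congrFun ((glue n).injective h1) l
    have h2 := fun l => congrFun ((glue n).injective h2) l
    have e1 := h1 a
    have e2 := h2 a
    by_cases hab : a = b
    · subst hab
      simp only [Pi.add_apply, Pi.single_eq_same] at e1 e2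
      obtain rfl := hdisj i i' (w a) (u a) (by rw [e1, e2, Sym2.eq_swap])
      have e1 := (C i).injective e1
      have e2 := (C i).injective e2
      refine natCast_ne_zero_of_lt (m := m) (r := 2) (by omega) (by omega) ?_
      push_cast
      linear_combination e2 - e1
    · simp only [Pi.add_apply, Pi.single_eq_same, Pi.single_eq_of_ne hab, add_zero] at e1 e2
      exact hsucc _ ((C i).injective (e1.trans e2.symm))

/-- If the cycles `C i` cover the edges of `torus 4 n`, then the products `C i × C i × C i` cover
those of `torus 4 (3 * n)`. -/
theorem glue_edges_cover {n m : ℕ} (C : Fin n → ZMod m ≃ (Fin n → ZMod 4))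
    (hcover : ∀ x y, (torus 4 n).Adj x y → ∃ i t, s(x, y) = s(C i t, C i (t + 1)))
    {x y : Fin (3 * n) → ZMod 4} (h : (torus 4 (3 * n)).Adj x y) :
    ∃ i a, ∃ w : Fin 3 → ZMod m, s(x, y) = s(glue n fun l => C i (w l),
      glue n fun l => C i (bump w a l)) := by
  -- The resting blocks are unrestricted, because `C i` passes through every vertex.
  have key : ∀ (X Y : Fin 3 → Fin n → ZMod 4) (a : Fin 3) (i : Fin n) (t : ZMod m),
      X a = C i t → Y a = C i (t + 1) → (∀ l, l ≠ a → X l = Y l) →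
      ∃ w : Fin 3 → ZMod m, X = (fun l => C i (w l)) ∧
        Y = fun l => C i (bump w a l) := by
    intro X Y a i t hX hY hXY
    refine ⟨fun l => (C i).symm (X l), by simp, funext fun l => ?_⟩
    by_cases hl : l = a
    · subst hl
      simp [hX, hY]
    · simp [hl, hXY l hl]
  obtain ⟨X, rfl⟩ := (glue n).surjective x
  obtain ⟨Y, rfl⟩ := (glue n).surjective y
  obtain ⟨a, hadj, hXY⟩ := (glue_adj X Y).1 h
  obtain ⟨i, t, hit⟩ := hcover _ _ hadj
  rcases Sym2.eq_iff.1 hit with ⟨h1, h2⟩ | ⟨h1, h2⟩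
  · obtain ⟨w, hX, hY⟩ := key X Y a i t h1 h2 hXY
    exact ⟨i, a, w, by rw [← hX, ← hY]⟩
  · obtain ⟨w, hY, hX⟩ := key Y X a i t h2 h1 (fun l hl => (hXY l hl).symm)
    exact ⟨i, a, w, by rw [← hX, ← hY, Sym2.eq_swap]⟩

/-- This computes the step out of `w` on the shifted cycle, in the form used by
`dir_shift_bijective`. -/
theorem next_comp_sub {m : ℕ} (j : Fin 3) (w : Fin 3 → ZMod m) :
    (fun l => next (fun i => w (i + j)) (l - j)) =
      bump w (dir (fun i => w (i + j)) + j) := by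
  funext l
  simp only [next, Pi.add_apply, sub_add_cancel]
  congr 1
  simp only [Pi.single_apply, sub_eq_iff_eq_add]

theorem four_pow_mod_six {n : ℕ} (hn : 0 < n) : 4 ^ n % 6 = 4 := by
  induction n, hn using Nat.le_induction with
  | base => rfl
  | succ n _ ih => rw [pow_succ, Nat.mul_mod, ih]

end HypercubeHD

/-- If `Q_{2n}` has a source cycle, then so does `Q_{6n}` (`6n = 2 · 3n`). -/
theorem corollary4 (n : ℕ) (h : HypercubeHD.HasSourceCycle n) :
    HypercubeHD.HasSourceCycle (3 * n) := by
  open HypercubeHD in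
  -- For n = 0 both cubes coincide, and 4^0 = 1 is too small for the construction.
  rcases Nat.eq_zero_or_pos n with rfl | hn
  · exact h
  obtain ⟨H, hH, σ, hσ, hdec⟩ := h
  set m := 4 ^ n with hm
  have hm4 : 4 ≤ m := by simpa using Nat.pow_le_pow_right (n := 4) (by norm_num) hn
  have : NeZero m := ⟨by omega⟩
  obtain ⟨c, hc0, hcadj, hcedges⟩ := exists_cyclic_enumeration _ hH (N := m)
    (by simp [hm, ZMod.card])
  let C : Fin n → ZMod m ≃ (Fin n → ZMod 4) := fun i => c.trans (axisIso (σ i)).toEquiv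
  have hedge : ∀ i ed, ed ∈ ((H.map (quaternary n).toHom).map (axisIso (σ i)).toHom).edges ↔
      ∃ t, ed = s(C i t, C i (t + 1)) := by
    intro i ed
    rw [SimpleGraph.Walk.edges_map, List.mem_map]
    constructor
    · rintro ⟨e, he, rfl⟩
      obtain ⟨t, rfl⟩ := (hcedges e).1 he
      exact ⟨t, rfl⟩
    · rintro ⟨t, rfl⟩
      exact ⟨_, (hcedges _).2 ⟨t, rfl⟩, rfl⟩
  have hdisj : ∀ i i' t t', s(C i t, C i (t + 1)) = s(C i' t', C i' (t' + 1)) → i = i' := by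
    intro i i' t t' he
    by_contra hne
    exact hdec.disjoint i i' hne _ ((hedge i _).2 ⟨t, rfl⟩) ((hedge i' _).2 ⟨t', he⟩)
  have hcover : ∀ x y, (torus 4 n).Adj x y → ∃ i t, s(x, y) = s(C i t, C i (t + 1)) := by
    intro x y hxy
    obtain ⟨i, hi⟩ := hdec.cover s(x, y) hxy
    exact ⟨i, (hedge i _).1 hi⟩
  let φ : (Fin 3 → ZMod m) ≃ (Fin (3 * n) → ZMod 4) :=
    ((Equiv.refl (Fin 3)).arrowCongr c).trans (glue n)
  have hφ : ∀ w, φ w = glue n fun l => c (w l) := fun w => rfl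
  have hφadj : ∀ w, (torus 4 (3 * n)).Adj (φ w) (φ (nextPerm hm4 w)) := by
    intro w
    rw [hφ, hφ, glue_adj]
    have hnext : nextPerm hm4 w = w + Pi.single (dir w) 1 := rfl
    refine ⟨dir w, ?_, fun l hl => ?_⟩
    · simpa [hnext] using hcadj (w (dir w))
    · simp [hnext, hl]
  obtain ⟨W, hW, hWedges⟩ := exists_isHamiltonianCycle_of_isCycleOn (nextPerm hm4)
    (nextPerm_isCycleOn hm4 (four_pow_mod_six hn)) φ hφadj (by
      have : m ≤ m ^ 3 := Nat.le_self_pow (by norm_num) m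
      simp [ZMod.card]; omega) 0
  have hblock : ∀ j i w, axisIso (blockPerm j (σ i)) (φ w) =
      glue n fun l => C i (w (l - j)) := fun j i w => by
    rw [hφ, axisIso_blockPerm]
    rfl
  -- The cycle indexed by (j, i) lies in C_i × C_i × C_i and leaves the point with parameters `w`
  -- along the axis given by the shift `j`.
  have hWmap : ∀ (j : Fin 3) (i : Fin n) (ed),
      ed ∈ (W.map (axisIso (blockPerm j (σ i))).toHom).edges ↔
      ∃ w : Fin 3 → ZMod m, ed = s(glue n fun l => C i (w l), glue n fun l =>
        C i (bump w (dir (fun i => w (i + j)) + j) l)) := by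
    intro j i ed
    have hstep : ∀ w : Fin 3 → ZMod m,
        Sym2.map (axisIso (blockPerm j (σ i))).toHom
          s(φ fun i => w (i + j), φ (nextPerm hm4 fun i => w (i + j))) =
        s(glue n fun l => C i (w l), glue n fun l =>
          C i (bump w (dir (fun i => w (i + j)) + j) l)) := by
      intro w
      rw [Sym2.map_mk, ← next_comp_sub]
      refine Sym2.eq_iff.2 (Or.inl ⟨?_, hblock j i _⟩)
      refine (hblock j i _).trans ?_
      simp
    rw [SimpleGraph.Walk.edges_map, List.mem_map]
    constructor
    · rintro ⟨e, he, rfl⟩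
      obtain ⟨w, rfl⟩ := (hWedges e).1 he
      refine ⟨fun l => w (l - j), ?_⟩
      rw [← hstep]
      simp
    · rintro ⟨w, rfl⟩
      exact ⟨_, (hWedges _).2 ⟨_, rfl⟩, hstep w⟩
  refine hasSourceCycle_of_torus W ⟨hW, blockFamily σ, hσ.blockFamily, ?_, ?_, ?_⟩ ?_
  · exact fun k => hW.map (axisIso _).bijective
  · intro k k' hne ed he he'
    obtain ⟨w, rfl⟩ := (hWmap _ _ _).1 he
    obtain ⟨u, hu⟩ := (hWmap _ _ _).1 he'
    obtain ⟨hi, hj, rfl⟩ := glue_edges_disjoint hm4 C hdisj hu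
    exact hne (finProdFinEquiv.symm.injective (Prod.ext ((dir_shift_bijective hm4 w).1 hj) hi))
  · intro ed hed
    induction ed using Sym2.ind with
    | _ x y =>
    obtain ⟨i, a, w, he⟩ := glue_edges_cover C hcover hed
    -- Exactly one shift leaves `w` along the axis `a`; this `j` selects the cycle containing the
    -- edge.
    obtain ⟨j, rfl⟩ := (dir_shift_bijective hm4 w).2 a
    refine ⟨finProdFinEquiv (j, i), (hWmap _ _ _).2 ⟨w, ?_⟩⟩
    rw [Equiv.symm_apply_apply]
    exact he
  · rw [hφ]
    funext k
    obtain ⟨⟨l, p⟩, rfl⟩ := finProdFinEquiv.surjective k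
    rw [glue_apply]
    simp only [Pi.zero_apply, hc0]
    rfl
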